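/- Let $m>1$, and for $1\le j\le m$ let $\ell_j:\mathbb R^n\to\mathbb R^{n_j}$ be a surjective linear map. Let $P:\mathbb R^n\to\mathbb R$ be a real polynomial and let $\varphi$ be a compactly supported, continuously differentiable (complex-valued) function on $\mathbb R^n$. For $\lambda\in\mathbb R$ and complex-valued measurable functions $f_j$ on $\mathbb R^{n_j}$ put $$\Lambda_\lambda(f_1,\dots,f_m)=\int_{\mathbb R^n}e^{i\lambda P(x)}\prod_{j=1}^m f_j(\ell_j(x))\,\varphi(x)\,dx .$$ Suppose that there exist $\delta>0$ and $C<\infty$ such that for all $f_j\in L^\infty(\mathbb R^{n_j})$ and all real $\lambda\neq0$ $$|\Lambda_\lambda(f_1,\dots,f_m)|\le C|\lambda|^{-\delta}\prod_{j=1}^m\|f_j\|_{L^\infty}.$$ Let $(p_1,\dots,p_m)\in[1,\infty]^m$ (with $\infty^{-1}=0$), and suppose that for every proper subspace $V\subsetneq\mathbb R^n$ (including $V=\{0\}$ when $n\ge1$) $$\operatorname{codim}_{\mathbb R^n}(V)>\sum_{j=1}^m p_j^{-1}\operatorname{codim}_{\mathbb R^{n_j}}(\ell_j(V)).$$ Then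 the integral defining $\Lambda_\lambda(f_1,\dots,f_m)$ converges absolutely for all $\lambda\in\mathbb R$ and all $f_j\in L^{p_j}(\mathbb R^{n_j})$, and there exist $\delta'>0$ and $C'<\infty$ (which may depend on $(p_1,\dots,p_m)$, as well as on $n$, $\ell_j$, $P$, $\varphi$, but not on $\lambda$ or the $f_j$) such that $$|\Lambda_\lambda(f_1,\dots,f_m)|\le C'|\lambda|^{-\delta'}\prod_{j=1}^m\|f_j\|_{L^{p_j}}$$ for all real $\lambda\neq0$ and all $f_j\in L^{p_j}(\mathbb R^{n_j})$. -/

import Mathlib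

open MeasureTheory
open scoped ENNReal

noncomputable section

/-- The codimension of a subspace `V` of a finite-dimensional real vector space `E`. -/
def codim {E : Type*} [AddCommGroup E] [Module ℝ E] (V : Submodule ℝ E) : ℕ :=
  Module.finrank ℝ (E ⧸ V)

/-- The integrand `e^{i lam P(x)} ∏ⱼ fⱼ(ℓⱼ x) φ(x)`. -/
def oscIntegrand {n m : ℕ} {d : Fin m → ℕ}
    (ℓ : (j : Fin m) → EuclideanSpace ℝ (Fin n) →ₗ[ℝ] EuclideanSpace ℝ (Fin (d j)))
    (P : MvPolynomial (Fin n) ℝ) (φ : EuclideanSpace ℝ (Fin n) → ℂ) (lam : ℝ)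
    (f : (j : Fin m) → EuclideanSpace ℝ (Fin (d j)) → ℂ)
    (x : EuclideanSpace ℝ (Fin n)) : ℂ :=
  Complex.exp (Complex.I * ((lam * MvPolynomial.eval (fun i => x i) P : ℝ) : ℂ)) *
    (∏ j, f j (ℓ j x)) * φ x

/-- The oscillatory form `Λ_lam(f₁, …, fₘ) = ∫ e^{i lam P(x)} ∏ⱼ fⱼ(ℓⱼ x) φ(x) dx`. -/
def oscForm {n m : ℕ} {d : Fin m → ℕ}
    (ℓ : (j : Fin m) → EuclideanSpace ℝ (Fin n) →ₗ[ℝ] EuclideanSpace ℝ (Fin (d j)))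
    (P : MvPolynomial (Fin n) ℝ) (φ : EuclideanSpace ℝ (Fin n) → ℂ) (lam : ℝ)
    (f : (j : Fin m) → EuclideanSpace ℝ (Fin (d j)) → ℂ) : ℂ :=
  ∫ x, oscIntegrand ℓ P φ lam f x

end

set_option linter.unusedSectionVars false

/-! With the phase discarded, the form is controlled by a local Brascamp–Lieb inequality: if the
numbers 1/p_j satisfy the dimension condition with `≤`, then ∫_K ∏ |f_j ∘ ℓ_j| ≤ C ∏ ‖f_j‖_{p_j} for
bounded K (`BLFeasible.lintegral_prod_enorm_le`). The condition sees V only through finitely many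
dimensions, so strictness leaves room to raise every 1/p_j by some ε > 0 (`exists_feasible_add`).
Cut each f_j at height τ‖f_j‖_{p_j}. The part above the cut gains τ^(-ε) in L^q, 1/q = 1/p_j + ε, so
by Brascamp–Lieb discarding these parts costs O(τ^(-ε)) (`exists_enorm_oscForm_sub_le`). What
remains is bounded, and the assumed decay gives |λ|^(-δ) τ^m. A small power of |λ| for τ makes both
terms decay.

The Brascamp–Lieb inequality (`localBL_of_finrank_eq`) is proved by induction on dim E and on the
number of active exponents. Admissible exponents form a convex set, so s may be replaced by two
points on a line through it at which a constraint becomes tight. A vanishing exponent drops a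
factor; a tight V other than 0 and E splits the problem by Fubini into two of lower dimension. If V
= 0 is tight, one moves along directions that keep it tight, until at most one active map is left; a
single one must be bijective. -/

/-! ### Local Brascamp–Lieb inequalities: convexity and base cases. -/

open Module in
/-- The weighted sum of the codimensions of the images of `V` under the maps `ℓ j`. -/
noncomputable def imageCodim {ι E : Type*} [Fintype ι] {F : ι → Type*} [AddCommGroup E]
    [Module ℝ E] [∀ j, AddCommGroup (F j)] [∀ j, Module ℝ (F j)] (ℓ : ∀ j, E →ₗ[ℝ] F j)
    (s : ι → ℝ) (V : Submodule ℝ E) : ℝ :=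
  ∑ j, s j * ((finrank ℝ (F j) : ℝ) - finrank ℝ (V.map (ℓ j)))

open Module in
/-- The dimension condition for the exponents `s` in a local Brascamp–Lieb inequality. -/
def BLFeasible {ι E : Type*} [Fintype ι] {F : ι → Type*} [AddCommGroup E] [Module ℝ E]
    [∀ j, AddCommGroup (F j)] [∀ j, Module ℝ (F j)] (ℓ : ∀ j, E →ₗ[ℝ] F j) (s : ι → ℝ) : Prop :=
  (∀ j, 0 ≤ s j) ∧ ∀ V : Submodule ℝ E,
    imageCodim ℓ s V ≤ finrank ℝ E - finrank ℝ V

/-- The local Brascamp–Lieb inequality with exponents `s`, for nonnegative functions. -/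
def LocalBL {ι E : Type*} [Fintype ι] {F : ι → Type*} [NormedAddCommGroup E] [NormedSpace ℝ E]
    [MeasurableSpace E] [∀ j, NormedAddCommGroup (F j)] [∀ j, NormedSpace ℝ (F j)]
    [∀ j, MeasurableSpace (F j)] (ℓ : ∀ j, E →ₗ[ℝ] F j) (s : ι → ℝ)
    (μ : Measure E) (ν : ∀ j, Measure (F j)) : Prop :=
  ∀ K : Set E, Bornology.IsBounded K → ∃ C : ℝ≥0∞, C ≠ ∞ ∧ ∀ g : ∀ j, F j → ℝ≥0∞,
    (∀ j, Measurable (g j)) →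
      ∫⁻ x in K, ∏ j, g j (ℓ j x) ^ s j ∂μ ≤ C * ∏ j, (∫⁻ y, g j y ∂ν j) ^ s j

theorem LinearEquiv.exists_map_addHaar_eq_nnreal_smul {E F : Type*}
    [NormedAddCommGroup E] [NormedSpace ℝ E] [FiniteDimensional ℝ E] [MeasurableSpace E]
    [BorelSpace E] [NormedAddCommGroup F] [NormedSpace ℝ F] [FiniteDimensional ℝ F]
    [MeasurableSpace F] [BorelSpace F] (e : E ≃ₗ[ℝ] F) (μ : Measure E) (ν : Measure F)
    [μ.IsAddHaarMeasure] [ν.IsAddHaarMeasure] :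
    ∃ c : NNReal, μ.map e = c • ν := by
  have : (μ.map e).IsAddHaarMeasure := e.toContinuousLinearEquiv.isAddHaarMeasure_map μ
  have : ProperSpace F := FiniteDimensional.proper_real F
  exact ⟨_, Measure.isAddLeftInvariant_eq_smul (μ.map e) ν⟩

section
variable {ι E : Type*} [Fintype ι] {F : ι → Type*} [NormedAddCommGroup E] [NormedSpace ℝ E]
    [FiniteDimensional ℝ E]
    [MeasurableSpace E] [BorelSpace E] [∀ j, NormedAddCommGroup (F j)] [∀ j, NormedSpace ℝ (F j)]
    [∀ j, FiniteDimensional ℝ (F j)]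
    [∀ j, MeasurableSpace (F j)] [∀ j, BorelSpace (F j)] {ℓ : ∀ j, E →ₗ[ℝ] F j} {s t : ι → ℝ}
    {μ : Measure E} {ν : ∀ j, Measure (F j)}

theorem measurable_prod_comp_rpow
    (ℓ : ∀ j, E →ₗ[ℝ] F j) (s : ι → ℝ) {g : ∀ j, F j → ℝ≥0∞} (hg : ∀ j, Measurable (g j)) :
    Measurable fun x => ∏ j, g j (ℓ j x) ^ s j :=
  Finset.measurable_fun_prod _ fun j _ =>
    ((hg j).comp (ℓ j).continuous_of_finiteDimensional.measurable).pow_const _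

/-- Interpolation: the exponents of local Brascamp–Lieb inequalities form a convex set. -/
theorem LocalBL.convex (hs : LocalBL ℓ s μ ν) (ht : LocalBL ℓ t μ ν) (hs0 : ∀ j, 0 ≤ s j)
    (ht0 : ∀ j, 0 ≤ t j) {a b : ℝ} (ha : 0 ≤ a) (hb : 0 ≤ b) (hab : a + b = 1) :
    LocalBL ℓ (fun j => a * s j + b * t j) μ ν := by
  intro K hK
  obtain ⟨C, hC, hCs⟩ := hs K hK
  obtain ⟨D, hD, hDt⟩ := ht K hK
  refine ⟨C ^ a * D ^ b, ENNReal.mul_ne_top (ENNReal.rpow_ne_top_of_nonneg ha hC)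
    (ENNReal.rpow_ne_top_of_nonneg hb hD), fun g hg => ?_⟩
  have key : ∀ h : ι → ℝ≥0∞, ∏ j, h j ^ (a * s j + b * t j)
      = (∏ j, h j ^ s j) ^ a * (∏ j, h j ^ t j) ^ b := by
    intro h
    rw [← ENNReal.prod_rpow_of_nonneg ha, ← ENNReal.prod_rpow_of_nonneg hb,
      ← Finset.prod_mul_distrib]
    refine Finset.prod_congr rfl fun j _ => ?_
    rw [← ENNReal.rpow_mul, ← ENNReal.rpow_mul, mul_comm (s j), mul_comm (t j),
      ENNReal.rpow_add_of_nonneg _ _ (mul_nonneg ha (hs0 j)) (mul_nonneg hb (ht0 j))]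
  simp only [key]
  refine (ENNReal.lintegral_mul_norm_pow_le (measurable_prod_comp_rpow ℓ s hg).aemeasurable
    (measurable_prod_comp_rpow ℓ t hg).aemeasurable ha hb hab).trans ?_
  calc _ ≤ (C * ∏ j, (∫⁻ y, g j y ∂ν j) ^ s j) ^ a * (D * ∏ j, (∫⁻ y, g j y ∂ν j) ^ t j) ^ b :=
        mul_le_mul' (ENNReal.rpow_le_rpow (hCs g hg) ha) (ENNReal.rpow_le_rpow (hDt g hg) hb)
    _ = _ := by
      rw [ENNReal.mul_rpow_of_nonneg _ _ ha, ENNReal.mul_rpow_of_nonneg _ _ hb]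
      exact mul_mul_mul_comm _ _ _ _

/-- The point `s` is the average of `s + a v` and `s - b v` with weights b/(a+b) and a/(a+b); for a
= 0 it is already the first endpoint. -/
theorem LocalBL.of_line {v : ι → ℝ} {a b : ℝ} (ha : 0 ≤ a) (hb : 0 ≤ b)
    (hsa : ∀ j, 0 ≤ s j + a * v j) (hsb : ∀ j, 0 ≤ s j + b * -v j)
    (h1 : LocalBL ℓ (fun j => s j + a * v j) μ ν) (h2 : LocalBL ℓ (fun j => s j + b * -v j) μ ν) :
    LocalBL ℓ s μ ν := by
  rcases ha.eq_or_lt with rfl | ha'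
  · simpa using h1
  have hab : 0 < a + b := by positivity
  have := h1.convex h2 hsa hsb (a := b / (a + b)) (b := a / (a + b)) (by positivity)
    (by positivity) (by field_simp; ring)
  convert this using 2 with j
  field_simp
  ring

/-- Factors with vanishing exponent or trivial space are constant. -/
theorem exists_rpow_le_lintegral_rpow {G : Type*} [NormedAddCommGroup G] [NormedSpace ℝ G]
    [FiniteDimensional ℝ G] [MeasurableSpace G] [BorelSpace G] (ν : Measure G)
    [ν.IsAddHaarMeasure] {r : ℝ} (hr : 0 ≤ r) (h : r = 0 ∨ Module.finrank ℝ G = 0) :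
    ∃ c : ℝ≥0∞, c ≠ ∞ ∧ ∀ (g : G → ℝ≥0∞) (y : G), g y ^ r ≤ c * (∫⁻ z, g z ∂ν) ^ r := by
  rcases h with rfl | h
  · exact ⟨1, by simp, by simp⟩
  have := Module.finrank_zero_iff.mp h
  have hν0 : ν Set.univ ≠ 0 := (Measure.measure_univ_pos.mpr (NeZero.ne ν)).ne'
  have : CompactSpace G := inferInstance
  have hνt : ν Set.univ ≠ ∞ := (isCompact_univ.measure_lt_top).ne
  refine ⟨(ν Set.univ)⁻¹ ^ r, ENNReal.rpow_ne_top_of_nonneg hr (by simpa using hν0),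
    fun g y => ?_⟩
  rw [← ENNReal.mul_rpow_of_nonneg _ _ hr]
  refine ENNReal.rpow_le_rpow ?_ hr
  have : ∫⁻ z, g z ∂ν = g y * ν Set.univ := by
    rw [← lintegral_const]
    exact lintegral_congr fun z => by rw [Subsingleton.elim z y]
  rw [this, mul_comm (g y), ← mul_assoc, ENNReal.inv_mul_cancel hν0 hνt, one_mul]

/-- All factors are bounded by constants, so only the finite measure of `K` is needed. Of the two
base cases, this is the one that needs `K` bounded. -/
theorem LocalBL.of_trivial [μ.IsAddHaarMeasure] [∀ j, (ν j).IsAddHaarMeasure]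
    (hs0 : ∀ j, 0 ≤ s j) (h : ∀ j, s j = 0 ∨ Module.finrank ℝ (F j) = 0) : LocalBL ℓ s μ ν := by
  intro K hK
  choose c hc hcg using fun j => exists_rpow_le_lintegral_rpow (ν j) (hs0 j) (h j)
  refine ⟨(∏ j, c j) * μ K, ENNReal.mul_ne_top (ENNReal.prod_ne_top fun j _ => hc j)
    hK.measure_lt_top.ne, fun g _ => ?_⟩
  calc _ ≤ ∫⁻ x in K, (∏ j, c j) * ∏ j, (∫⁻ y, g j y ∂ν j) ^ s j ∂μ := by
        refine lintegral_mono fun x => ?_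
        rw [← Finset.prod_mul_distrib]
        exact Finset.prod_le_prod' fun j _ => hcg j (g j) _
    _ = _ := by
      rw [setLIntegral_const]
      ring

/-- A linear change of variables turns the one nonconstant factor into its own integral, up to the
ratio of Haar measures. -/
theorem LocalBL.of_bijective [DecidableEq ι] [μ.IsAddHaarMeasure] [∀ j, (ν j).IsAddHaarMeasure]
    (hs0 : ∀ j, 0 ≤ s j) (i : ι) (h : ∀ j, j ≠ i → s j = 0 ∨ Module.finrank ℝ (F j) = 0)
    (hi : s i = 1) (hb : Function.Bijective (ℓ i)) : LocalBL ℓ s μ ν := by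
  intro K _
  choose c hc hcg using fun j : {j // j ≠ i} =>
    exists_rpow_le_lintegral_rpow (ν j) (hs0 j) (h j j.2)
  obtain ⟨a, ha⟩ :=
    (LinearEquiv.ofBijective (ℓ i) hb).exists_map_addHaar_eq_nnreal_smul μ (ν i)
  have split : ∀ u : ι → ℝ≥0∞, ∏ j, u j = u i * ∏ j : {j // j ≠ i}, u j := fun u =>
    Fintype.prod_eq_mul_prod_subtype_ne u i
  refine ⟨(∏ j, c j) * a, ENNReal.mul_ne_top (ENNReal.prod_ne_top fun j _ => hc j)
    ENNReal.coe_ne_top, fun g hg => ?_⟩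
  have hmi : Measurable fun x => g i (ℓ i x) :=
    (hg i).comp (ℓ i).continuous_of_finiteDimensional.measurable
  have hint : ∫⁻ x, g i (ℓ i x) ∂μ = a * ∫⁻ y, g i y ∂ν i := by
    have h2 := lintegral_map (μ := μ) (hg i) (ℓ i).continuous_of_finiteDimensional.measurable
    change μ.map (ℓ i) = _ at ha
    rw [← h2, ha, lintegral_smul_measure]
    rfl
  calc _ ≤ ∫⁻ x in K, g i (ℓ i x) *
        ((∏ j, c j) * ∏ j : {j // j ≠ i}, (∫⁻ y, g j y ∂ν j) ^ s j) ∂μ := by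
        refine lintegral_mono fun x => ?_
        rw [split, hi, ENNReal.rpow_one, ← Finset.prod_mul_distrib]
        exact mul_le_mul_right (Finset.prod_le_prod' fun j _ => hcg j (g j) _) _
    _ ≤ ∫⁻ x, g i (ℓ i x) *
        ((∏ j, c j) * ∏ j : {j // j ≠ i}, (∫⁻ y, g j y ∂ν j) ^ s j) ∂μ := setLIntegral_le_lintegral _ _
    _ = _ := by
      rw [lintegral_mul_const _ hmi, hint, split fun j => (∫⁻ y, g j y ∂ν j) ^ s j, hi,
        ENNReal.rpow_one]
      ring

end

/-! ### Splitting the inequality along a subspace. -/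

section
variable {ι E : Type*} [Fintype ι] {F : ι → Type*} [NormedAddCommGroup E] [NormedSpace ℝ E]
    [FiniteDimensional ℝ E]
    [MeasurableSpace E] [BorelSpace E] [∀ j, NormedAddCommGroup (F j)] [∀ j, NormedSpace ℝ (F j)]
    [∀ j, FiniteDimensional ℝ (F j)]
    [∀ j, MeasurableSpace (F j)] [∀ j, BorelSpace (F j)] {ℓ : ∀ j, E →ₗ[ℝ] F j} {s : ι → ℝ}
    {μ : Measure E} {ν : ∀ j, Measure (F j)}

/-- The map induced by `f` from a complement of `V` to a complement of the image of `V`. -/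
noncomputable def complMap {E F : Type*} [AddCommGroup E] [Module ℝ E] [AddCommGroup F] [Module ℝ F]
    (f : E →ₗ[ℝ] F) (V V' : Submodule ℝ E) (H : Submodule ℝ F) (hH : IsCompl H (V.map f)) :
    V' →ₗ[ℝ] H :=
  H.projectionOnto (V.map f) hH ∘ₗ f ∘ₗ V'.subtype

/-- Factorization of a local Brascamp–Lieb inequality through a subspace, by Fubini. -/
theorem LocalBL.of_isCompl [μ.IsAddHaarMeasure] [∀ j, (ν j).IsAddHaarMeasure]
    (hs0 : ∀ j, 0 ≤ s j) {V V' : Submodule ℝ E} (hV : IsCompl V V')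
    {H : ∀ j, Submodule ℝ (F j)} (hH : ∀ j, IsCompl (H j) (V.map (ℓ j)))
    {μ₁ : Measure V} {μ₂ : Measure V'} [μ₁.IsAddHaarMeasure] [μ₂.IsAddHaarMeasure]
    {ν₁ : ∀ j, Measure (V.map (ℓ j))} {ν₂ : ∀ j, Measure (H j)}
    [∀ j, (ν₁ j).IsAddHaarMeasure] [∀ j, (ν₂ j).IsAddHaarMeasure]
    (h₁ : LocalBL (fun j => (ℓ j).submoduleMap V) s μ₁ ν₁)
    (h₂ : LocalBL (fun j => complMap (ℓ j) V V' (H j) (hH j)) s μ₂ ν₂) :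
    LocalBL ℓ s μ ν := by
  intro K hK
  let e : (V × V') ≃L[ℝ] E := (V.prodEquivOfIsCompl V' hV).toContinuousLinearEquiv
  let me : (V × V') ≃ᵐ E := e.toHomeomorph.toMeasurableEquiv
  obtain ⟨c, hc⟩ := e.symm.toLinearEquiv.exists_map_addHaar_eq_nnreal_smul μ (μ₁.prod μ₂)
  have hμ : μ = (c • μ₁.prod μ₂).map me := by
    rw [← hc]
    exact (me.map_map_symm).symm
  let eF : ∀ j, (V.map (ℓ j) × H j) ≃ₗ[ℝ] F j := fun j =>
    (V.map (ℓ j)).prodEquivOfIsCompl (H j) (hH j).symm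
  choose b hb using fun j => (eF j).exists_map_addHaar_eq_nnreal_smul ((ν₁ j).prod (ν₂ j)) (ν j)
  let K₁ : Set V := (ContinuousLinearMap.fst ℝ V V' ∘L e.symm.toContinuousLinearMap) '' K
  let K₂ : Set V' := (ContinuousLinearMap.snd ℝ V V' ∘L e.symm.toContinuousLinearMap) '' K
  have hK₁ : Bornology.IsBounded K₁ := (ContinuousLinearMap.lipschitz _).isBounded_image hK
  have hK₂ : Bornology.IsBounded K₂ := (ContinuousLinearMap.lipschitz _).isBounded_image hK
  have hsub : me ⁻¹' K ⊆ K₁ ×ˢ K₂ := fun p hp =>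
    ⟨⟨me p, hp, congrArg Prod.fst (e.symm_apply_apply p)⟩,
      ⟨me p, hp, congrArg Prod.snd (e.symm_apply_apply p)⟩⟩
  obtain ⟨C, hC, hCg⟩ := h₁ K₁ hK₁
  obtain ⟨D, hD, hDg⟩ := h₂ K₂ hK₂
  refine ⟨c * (C * D) * ∏ j, (b j : ℝ≥0∞) ^ s j, ENNReal.mul_ne_top (ENNReal.mul_ne_top
    ENNReal.coe_ne_top (ENNReal.mul_ne_top hC hD)) (ENNReal.prod_ne_top fun j _ =>
      ENNReal.rpow_ne_top_of_nonneg (hs0 j) ENNReal.coe_ne_top), fun g hg => ?_⟩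
  have hFm := measurable_prod_comp_rpow ℓ s hg
  set Φ : E → ℝ≥0∞ := fun x => ∏ j, g j (ℓ j x) ^ s j
  let G : ∀ j, V.map (ℓ j) × H j → ℝ≥0∞ := fun j p => g j (p.1 + p.2)
  have hG : ∀ j, Measurable (G j) := fun j => (hg j).comp (by fun_prop)
  -- The marginal of `g j` along the image of `V`: the inequality on `V` produces these functions,
  -- and the inequality on `V'` is then applied to them.
  let G' : ∀ j, H j → ℝ≥0∞ := fun j h => ∫⁻ u, G j (u, h) ∂ν₁ j
  have hG' : ∀ j, Measurable (G' j) := fun j => (hG j).lintegral_prod_left'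
  have hGint : ∀ j, ∫⁻ h, G' j h ∂ν₂ j = b j * ∫⁻ y, g j y ∂ν j := by
    intro j
    rw [← lintegral_prod_symm _ (hG j).aemeasurable]
    have h2 := lintegral_map (μ := (ν₁ j).prod (ν₂ j)) (hg j)
      (eF j).toContinuousLinearEquiv.continuous.measurable
    change _ = ∫⁻ p, G j p ∂_ at h2
    rw [← h2]
    change ∫⁻ y, g j y ∂(Measure.map (eF j) _) = _
    rw [hb, lintegral_smul_measure]
    rfl
  have inner : ∀ y : V', ∫⁻ x in K₁, Φ (me (x, y)) ∂μ₁ ≤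
      C * ∏ j, G' j (complMap (ℓ j) V V' (H j) (hH j) y) ^ s j := by
    intro y
    -- The component of `ℓ j y` in the image of `V` only translates the function on that image, and
    -- its integral is translation invariant.
    let a : ∀ j, V.map (ℓ j) := fun j =>
      (V.map (ℓ j)).projectionOnto (H j) (hH j).symm (ℓ j y)
    have hdec : ∀ j, ℓ j y = a j + (complMap (ℓ j) V V' (H j) (hH j) y : F j) := fun j =>
      (Submodule.projection_add_projection_eq_self (hH j).symm (ℓ j y)).symm
    have hm : ∀ j, Measurable fun u : V.map (ℓ j) =>
        G j (u + a j, complMap (ℓ j) V V' (H j) (hH j) y) := fun j => (hG j).comp (by fun_prop)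
    have := hCg _ hm
    refine (le_of_eq ?_).trans (this.trans (le_of_eq ?_))
    · refine lintegral_congr fun x => ?_
      refine Finset.prod_congr rfl fun j _ => ?_
      congr 1
      change g j (ℓ j (x + y)) = g j (_ + _)
      rw [map_add, hdec j]
      congr 1
      simp [add_assoc]
    · congr 1
      refine Finset.prod_congr rfl fun j _ => ?_
      congr 1
      exact lintegral_add_right_eq_self
        (fun u => G j (u, complMap (ℓ j) V V' (H j) (hH j) y)) (a j)
  calc ∫⁻ x in K, Φ x ∂μ = c * ∫⁻ p in me ⁻¹' K, Φ (me p) ∂μ₁.prod μ₂ := by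
        rw [hμ, me.restrict_map, lintegral_map_equiv, Measure.restrict_smul,
          lintegral_smul_measure]
        rfl
    _ ≤ c * ∫⁻ p in K₁ ×ˢ K₂, Φ (me p) ∂μ₁.prod μ₂ := by
        gcongr
    _ = c * ∫⁻ y in K₂, ∫⁻ x in K₁, Φ (me (x, y)) ∂μ₁ ∂μ₂ := by
        rw [← Measure.prod_restrict, lintegral_prod_symm (fun p => Φ (me p)) (hFm.comp me.measurable).aemeasurable]
    _ ≤ c * ∫⁻ y in K₂, C * ∏ j, G' j (complMap (ℓ j) V V' (H j) (hH j) y) ^ s j ∂μ₂ := by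
        gcongr with y
        exact inner y
    _ ≤ c * (C * (D * ∏ j, (∫⁻ h, G' j h ∂ν₂ j) ^ s j)) := by
        rw [lintegral_const_mul _ (measurable_prod_comp_rpow _ s hG')]
        gcongr
        exact hDg G' hG'
    _ = _ := by
        simp only [hGint, ENNReal.mul_rpow_of_nonneg _ _ (hs0 _), Finset.prod_mul_distrib]
        ring

open Module in
theorem finrank_map_submoduleMap {E F : Type*} [AddCommGroup E] [Module ℝ E] [AddCommGroup F]
    [Module ℝ F] (f : E →ₗ[ℝ] F) (V : Submodule ℝ E) (W : Submodule ℝ V) :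
    finrank ℝ (W.map (f.submoduleMap V)) = finrank ℝ ((W.map V.subtype).map f) := by
  rw [← Submodule.finrank_map_subtype_eq, ← Submodule.map_comp, ← Submodule.map_comp]
  rfl

-- The vectors `f x` and `complMap f V V' H hH x` differ by an element of the image of `V`, and `H`
-- meets that image trivially.
open Module in
theorem finrank_map_complMap {E F : Type*} [AddCommGroup E] [Module ℝ E] [AddCommGroup F]
    [Module ℝ F] [FiniteDimensional ℝ F] [FiniteDimensional ℝ E]
    (f : E →ₗ[ℝ] F) (V V' : Submodule ℝ E) (H : Submodule ℝ F)
    (hH : IsCompl H (V.map f)) (W : Submodule ℝ V') :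
    finrank ℝ ((V ⊔ W.map V'.subtype).map f)
      = finrank ℝ (V.map f) + finrank ℝ (W.map (complMap f V V' H hH)) := by
  have h1 : (V ⊔ W.map V'.subtype).map f
      = V.map f ⊔ (W.map (complMap f V V' H hH)).map H.subtype := by
    rw [Submodule.map_sup]
    have hdec : ∀ x : V', f x - (complMap f V V' H hH x : F) ∈ V.map f := by
      intro x
      have := Submodule.projection_add_projection_eq_self hH (f x)
      have h3 : f x - (complMap f V V' H hH x : F) = (V.map f).projection H hH.symm (f x) := by
        rw [sub_eq_iff_eq_add']
        exact this.symm
      rw [h3]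
      exact Submodule.projection_apply_mem _ _
    apply le_antisymm
    · refine sup_le le_sup_left ?_
      rintro _ ⟨_, ⟨x, hx, rfl⟩, rfl⟩
      have := Submodule.add_mem_sup (hdec x)
        (Submodule.mem_map_of_mem (f := H.subtype) (Submodule.mem_map_of_mem
          (f := complMap f V V' H hH) hx))
      simpa using this
    · refine sup_le le_sup_left ?_
      rintro _ ⟨_, ⟨x, hx, rfl⟩, rfl⟩
      have := Submodule.add_mem_sup ((V.map f).neg_mem (hdec x))
        (Submodule.mem_map_of_mem (f := f) (Submodule.mem_map_of_mem (f := V'.subtype) hx))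
      simpa using this
  have h2 : V.map f ⊓ (W.map (complMap f V V' H hH)).map H.subtype = ⊥ :=
    (hH.symm.disjoint.mono_right (Submodule.map_subtype_le _ _)).eq_bot
  have h3 := Submodule.finrank_sup_add_finrank_inf_eq (V.map f)
    ((W.map (complMap f V V' H hH)).map H.subtype)
  rw [h2, finrank_bot, add_zero, Submodule.finrank_map_subtype_eq] at h3
  rw [h1, h3]

-- Tightness at `V` is essential here: subtracting that equality from the condition for `W` inside
-- `E` leaves the condition for `W` inside `V`.
open Module in
theorem BLFeasible.submoduleMap (hs : BLFeasible ℓ s) {V : Submodule ℝ E}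
    (hV : imageCodim ℓ s V = finrank ℝ E - finrank ℝ V) :
    BLFeasible (fun j => (ℓ j).submoduleMap V) s := by
  refine ⟨hs.1, fun W => ?_⟩
  have h := hs.2 (W.map V.subtype)
  simp only [imageCodim] at h hV ⊢
  simp only [finrank_map_submoduleMap]
  rw [Submodule.finrank_map_subtype_eq] at h
  have : ∑ j, s j * ((finrank ℝ (V.map (ℓ j)) : ℝ) - finrank ℝ ((W.map V.subtype).map (ℓ j)))
    = ∑ j, s j * ((finrank ℝ (F j) : ℝ) - finrank ℝ ((W.map V.subtype).map (ℓ j)))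
      - ∑ j, s j * ((finrank ℝ (F j) : ℝ) - finrank ℝ (V.map (ℓ j))) := by
    rw [← Finset.sum_sub_distrib]
    exact Finset.sum_congr rfl fun j _ => by ring
  rw [this]
  linarith

-- The condition for `W` in the complement is the condition for `V ⊔ W` in `E`; tightness plays no
-- role.
open Module in
theorem BLFeasible.complMap (hs : BLFeasible ℓ s) {V V' : Submodule ℝ E} (hV : IsCompl V V')
    {H : ∀ j, Submodule ℝ (F j)} (hH : ∀ j, IsCompl (H j) (V.map (ℓ j))) :
    BLFeasible (fun j => complMap (ℓ j) V V' (H j) (hH j)) s := by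
  refine ⟨hs.1, fun W => ?_⟩
  have h := hs.2 (V ⊔ W.map V'.subtype)
  have hd := Submodule.finrank_add_eq_of_isCompl hV
  have hdj := fun j => Submodule.finrank_add_eq_of_isCompl (hH j)
  have h3 := Submodule.finrank_sup_add_finrank_inf_eq V (W.map V'.subtype)
  rw [(hV.disjoint.mono_right (Submodule.map_subtype_le _ _)).eq_bot, finrank_bot, add_zero,
    Submodule.finrank_map_subtype_eq] at h3
  simp only [imageCodim] at h ⊢
  simp only [finrank_map_complMap (ℓ _) V V' (H _) (hH _), h3, ← hd, ← hdj] at h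
  push_cast at h
  convert h using 1
  · exact Finset.sum_congr rfl fun j _ => by ring
  · ring
end

/-! ### Moving exponents until a constraint becomes tight. -/

/-- In a pair `p`, read `p.1` as the slack of a constraint and `p.2` as the rate at which it is used
up. The time sought is the least ratio among positive rates. -/
theorem Set.Finite.exists_hitting_time {T : Set (ℝ × ℝ)} (hT : T.Finite) (h0 : ∀ p ∈ T, 0 ≤ p.1)
    (hpos : ∃ p ∈ T, 0 < p.2) :
    ∃ t : ℝ, 0 ≤ t ∧ (∀ p ∈ T, t * p.2 ≤ p.1) ∧ ∃ p ∈ T, 0 < p.2 ∧ t * p.2 = p.1 := by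
  obtain ⟨q, ⟨hqT, hq⟩, hmin⟩ := Set.exists_min_image {p ∈ T | 0 < p.2} (fun p => p.1 / p.2)
    (hT.subset (Set.sep_subset _ _)) hpos
  refine ⟨q.1 / q.2, div_nonneg (h0 q hqT) hq.le, fun p hp => ?_, q, hqT, hq,
    div_mul_cancel₀ _ hq.ne'⟩
  rcases lt_or_ge 0 p.2 with h | h
  · exact (le_div_iff₀ h).mp (hmin p ⟨hp, h⟩)
  · exact (mul_nonpos_of_nonneg_of_nonpos (div_nonneg (h0 q hqT) hq.le) h).trans (h0 p hp)

section
open Module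
variable {ι E : Type*} [Fintype ι] {F : ι → Type*} [AddCommGroup E] [Module ℝ E]
    [FiniteDimensional ℝ E] [∀ j, AddCommGroup (F j)] [∀ j, Module ℝ (F j)]
    [∀ j, FiniteDimensional ℝ (F j)] {ℓ : ∀ j, E →ₗ[ℝ] F j} {s : ι → ℝ}

/-- Infinitely many subspaces thus impose only finitely many distinct constraints, so a first
hitting time exists. -/
theorem finite_range_finrank_map (ℓ : ∀ j, E →ₗ[ℝ] F j) {α : Type*} (Φ : ℕ × (ι → ℕ) → α) :
    (Set.range fun V : Submodule ℝ E =>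
      Φ (finrank ℝ V, fun j => finrank ℝ (V.map (ℓ j)))).Finite := by
  have h : ((Set.Iic (finrank ℝ E)) ×ˢ
      (Set.univ.pi fun j : ι => Set.Iic (finrank ℝ (F j)))).Finite :=
    (Set.finite_Iic _).prod (Set.Finite.pi fun j => Set.finite_Iic _)
  refine (h.image Φ).subset ?_
  rintro _ ⟨V, rfl⟩
  exact ⟨(finrank ℝ V, fun j => finrank ℝ (V.map (ℓ j))),
    ⟨V.finrank_le, fun j _ => Submodule.finrank_le (V.map (ℓ j))⟩, rfl⟩

theorem imageCodim_add_mul (ℓ : ∀ j, E →ₗ[ℝ] F j) (s v : ι → ℝ) (t : ℝ) (V : Submodule ℝ E) :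
    imageCodim ℓ (fun j => s j + t * v j) V = imageCodim ℓ s V + t * imageCodim ℓ v V := by
  simp only [imageCodim, Finset.mul_sum, ← Finset.sum_add_distrib]
  exact Finset.sum_congr rfl fun j _ => by ring

theorem imageCodim_neg (ℓ : ∀ j, E →ₗ[ℝ] F j) (v : ι → ℝ) (V : Submodule ℝ E) :
    imageCodim ℓ (fun j => -v j) V = -imageCodim ℓ v V := by
  simp [imageCodim]

theorem imageCodim_bot (ℓ : ∀ j, E →ₗ[ℝ] F j) (v : ι → ℝ) :
    imageCodim ℓ v ⊥ = ∑ j, v j * finrank ℝ (F j) := by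
  refine Finset.sum_congr rfl fun j _ => ?_
  rw [Submodule.map_bot, finrank_bot, Nat.cast_zero, sub_zero]

theorem imageCodim_top (hℓ : ∀ j, Function.Surjective (ℓ j)) (v : ι → ℝ) :
    imageCodim ℓ v ⊤ = 0 := by
  refine Finset.sum_eq_zero fun j _ => ?_
  rw [Submodule.map_top, LinearMap.range_eq_top.mpr (hℓ j), finrank_top, sub_self, mul_zero]

/-- Moving feasible exponents in a bounded direction, one arrives at a newly tight constraint. -/
theorem BLFeasible.exists_tight (hs : BLFeasible ℓ s) (v : ι → ℝ)
    (hv : (∃ j, v j < 0) ∨ ∃ V, 0 < imageCodim ℓ v V) :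
    ∃ t : ℝ, 0 ≤ t ∧ BLFeasible ℓ (fun j => s j + t * v j) ∧
      ((∃ j, v j < 0 ∧ s j + t * v j = 0) ∨ ∃ V, 0 < imageCodim ℓ v V ∧
        imageCodim ℓ (fun j => s j + t * v j) V = finrank ℝ E - finrank ℝ V) := by
  let T₁ : Set (ℝ × ℝ) := Set.range fun j => (s j, -v j)
  let T₂ : Set (ℝ × ℝ) := Set.range fun V : Submodule ℝ E =>
    ((finrank ℝ E : ℝ) - finrank ℝ V - imageCodim ℓ s V, imageCodim ℓ v V)
  have hT₂ : T₂.Finite := finite_range_finrank_map ℓ fun p : ℕ × (ι → ℕ) =>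
    ((finrank ℝ E : ℝ) - p.1 - ∑ j, s j * ((finrank ℝ (F j) : ℝ) - p.2 j),
      ∑ j, v j * ((finrank ℝ (F j) : ℝ) - p.2 j))
  obtain ⟨t, ht, hle, heq⟩ := ((Set.finite_range _).union hT₂ :
      (T₁ ∪ T₂).Finite).exists_hitting_time (by
    rintro p (⟨j, rfl⟩ | ⟨V, rfl⟩)
    · exact hs.1 j
    · have := hs.2 V
      dsimp only
      linarith) (by
    rcases hv with ⟨j, hj⟩ | ⟨V, hV⟩
    · exact ⟨_, Or.inl ⟨j, rfl⟩, neg_pos.mpr hj⟩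
    · exact ⟨_, Or.inr ⟨V, rfl⟩, hV⟩)
  refine ⟨t, ht, ⟨fun j => ?_, fun V => ?_⟩, ?_⟩
  · have := hle _ (Or.inl ⟨j, rfl⟩)
    dsimp only at this
    linarith
  · have := hle _ (Or.inr ⟨V, rfl⟩)
    dsimp only at this
    rw [imageCodim_add_mul]
    linarith
  · rcases heq with ⟨p, ⟨j, rfl⟩ | ⟨V, rfl⟩, hp, hpt⟩
    · dsimp only at hp hpt
      exact Or.inl ⟨j, by linarith, by linarith⟩
    · dsimp only at hp hpt
      refine Or.inr ⟨V, hp, ?_⟩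
      rw [imageCodim_add_mul]
      linarith

theorem complMap_surjective {E F : Type*} [AddCommGroup E] [Module ℝ E] [AddCommGroup F]
    [Module ℝ F] {f : E →ₗ[ℝ] F} (hf : Function.Surjective f) {V V' : Submodule ℝ E}
    (hV : IsCompl V V') {H : Submodule ℝ F} (hH : IsCompl H (V.map f)) :
    Function.Surjective (complMap f V V' H hH) := by
  intro h
  obtain ⟨x, hx⟩ := hf h
  obtain ⟨u, u', rfl, -⟩ := Submodule.existsUnique_add_of_isCompl hV x
  refine ⟨u', ?_⟩
  have h1 : H.projectionOnto (V.map f) hH (f u) = 0 :=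
    (Submodule.projectionOnto_apply_eq_zero_iff hH).mpr (Submodule.mem_map_of_mem u.2)
  have h2 : H.projectionOnto (V.map f) hH (f (u + u')) = h := by
    rw [hx, Submodule.projectionOnto_apply_left]
  rw [map_add, map_add, h1, zero_add] at h2
  exact h2

/-- Tightness at 0 reads s_i dim F_i = dim E, while the constraint at ker ℓ_i gives s_i dim F_i ≤
dim F_i. Hence dim E ≤ dim F_i and the kernel vanishes. -/
theorem BLFeasible.eq_one_and_bijective [DecidableEq ι] (hs : BLFeasible ℓ s)
    (hℓ : ∀ j, Function.Surjective (ℓ j)) {i : ι} (hi : finrank ℝ (F i) ≠ 0)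
    (h : ∀ j, j ≠ i → s j = 0 ∨ finrank ℝ (F j) = 0) (ht : imageCodim ℓ s ⊥ = finrank ℝ E) :
    s i = 1 ∧ Function.Bijective (ℓ i) := by
  have h1 : s i * finrank ℝ (F i) = finrank ℝ E := by
    rw [← ht, imageCodim_bot, Finset.sum_eq_single i]
    · intro j _ hj
      rcases h j hj with h | h <;> simp [h]
    · simp
  have hrn := (ℓ i).finrank_range_add_finrank_ker
  rw [LinearMap.range_eq_top.mpr (hℓ i), finrank_top] at hrn
  have h2 : s i * finrank ℝ (F i) ≤ finrank ℝ (F i) := by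
    have := hs.2 (LinearMap.ker (ℓ i))
    have h3 : s i * finrank ℝ (F i) ≤ imageCodim ℓ s (LinearMap.ker (ℓ i)) := by
      refine le_trans (le_of_eq ?_) (Finset.single_le_sum (fun j _ => mul_nonneg (hs.1 j)
        (sub_nonneg.mpr (by exact_mod_cast Submodule.finrank_le _))) (Finset.mem_univ i))
      have : (LinearMap.ker (ℓ i)).map (ℓ i) = ⊥ := by
        rw [eq_bot_iff]
        rintro _ ⟨x, hx, rfl⟩
        exact hx
      rw [this]
      simp
    rw [← hrn] at this
    push_cast at this
    linarith
  have hker : finrank ℝ (LinearMap.ker (ℓ i)) = 0 := by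
    have : (finrank ℝ (LinearMap.ker (ℓ i)) : ℝ) ≤ 0 := by
      rw [← hrn] at h1
      push_cast at h1
      linarith
    exact_mod_cast le_antisymm this (Nat.cast_nonneg _)
  refine ⟨?_, LinearMap.ker_eq_bot.mp (Submodule.finrank_eq_zero.mp hker), hℓ i⟩
  rw [hker, add_zero] at hrn
  rw [← hrn] at h1
  have : (finrank ℝ (F i) : ℝ) ≠ 0 := by exact_mod_cast hi
  exact mul_right_cancel₀ this (by rw [h1, one_mul])
end

-- The induction proving the local Brascamp–Lieb inequality.

universe u v w
open Module in
theorem localBL_of_finrank_eq {ι : Type w} [Fintype ι] (n : ℕ) :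
    ∀ {E : Type u} {F : ι → Type v} [NormedAddCommGroup E] [NormedSpace ℝ E]
    [FiniteDimensional ℝ E] [MeasurableSpace E] [BorelSpace E]
    [∀ j, NormedAddCommGroup (F j)] [∀ j, NormedSpace ℝ (F j)] [∀ j, FiniteDimensional ℝ (F j)]
    [∀ j, MeasurableSpace (F j)] [∀ j, BorelSpace (F j)] {ℓ : ∀ j, E →ₗ[ℝ] F j} {s : ι → ℝ}
    {μ : Measure E} {ν : ∀ j, Measure (F j)} [μ.IsAddHaarMeasure] [∀ j, (ν j).IsAddHaarMeasure],
    finrank ℝ E = n → (∀ j, Function.Surjective (ℓ j)) → BLFeasible ℓ s → LocalBL ℓ s μ ν := by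
  classical
  induction n using Nat.strong_induction_on with
  | _ n ih =>
  intro E F _ _ _ _ _ _ _ _ _ _ ℓ s μ ν _ _ hn hℓ hs
  have factor : ∀ s : ι → ℝ, BLFeasible ℓ s → ∀ V : Submodule ℝ E, V ≠ ⊥ → V ≠ ⊤ →
      imageCodim ℓ s V = finrank ℝ E - finrank ℝ V → LocalBL ℓ s μ ν := by
    intro s hs V hb ht hV
    obtain ⟨V', hV'⟩ := V.exists_isCompl
    choose H hH using fun j => (V.map (ℓ j)).exists_isCompl
    have hd := Submodule.finrank_add_eq_of_isCompl hV'
    have hpos : finrank ℝ V ≠ 0 := fun h => hb (Submodule.finrank_eq_zero.mp h)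
    have hlt := Submodule.finrank_lt ht
    exact LocalBL.of_isCompl hs.1 hV' (fun j => (hH j).symm)
      (μ₁ := Measure.addHaar) (μ₂ := Measure.addHaar) (ν₁ := fun j => Measure.addHaar)
      (ν₂ := fun j => Measure.addHaar)
      (ih _ (by omega) rfl (fun j => (ℓ j).submoduleMap_surjective V) (hs.submoduleMap hV))
      (ih _ (by omega) rfl (fun j => complMap_surjective (hℓ j) hV' (hH j).symm)
        (hs.complMap hV' _))
  -- The active indices, whose factors are not trivially constant; their number drives the inner
  -- induction.
  let J : (ι → ℝ) → Finset ι := fun s =>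
    Finset.univ.filter fun j => s j ≠ 0 ∧ finrank ℝ (F j) ≠ 0
  have hJ : ∀ s j, j ∈ J s ↔ s j ≠ 0 ∧ finrank ℝ (F j) ≠ 0 := fun s j => by simp [J]
  have hJsub : ∀ s v : ι → ℝ, (∀ j, v j ≠ 0 → j ∈ J s) → ∀ t : ℝ,
      J (fun j => s j + t * v j) ⊆ J s := by
    intro s v hv t j hj
    by_contra hns
    have hvj : v j = 0 := by
      by_contra h
      exact hns (hv j h)
    rw [hJ] at hj hns
    simp only [hvj, mul_zero, add_zero] at hj
    exact hns hj
  -- Moving along `v` ends in one of three ways: an exponent vanishes (fewer active indices), a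
  -- proper nonzero subspace becomes tight (`factor`), or 0 does, which is left to the last
  -- hypothesis. The whole space never does, as its constraint is constant along `v`.
  have move : ∀ s : ι → ℝ, BLFeasible ℓ s →
      (∀ s', BLFeasible ℓ s' → (J s').card < (J s).card → LocalBL ℓ s' μ ν) →
      ∀ v : ι → ℝ, (∀ j, v j ≠ 0 → j ∈ J s) → ((∃ j, v j < 0) ∨ ∃ V, 0 < imageCodim ℓ v V) →
      (∀ s', BLFeasible ℓ s' → J s' ⊆ J s → 0 < imageCodim ℓ v ⊥ →
        imageCodim ℓ s' ⊥ = finrank ℝ E → LocalBL ℓ s' μ ν) →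
      ∃ t : ℝ, 0 ≤ t ∧ BLFeasible ℓ (fun j => s j + t * v j) ∧
        LocalBL ℓ (fun j => s j + t * v j) μ ν := by
    intro s hs hlt v hv hvb hbot
    obtain ⟨t, ht, hst, ⟨j, hj, hj0⟩ | ⟨V, hV, hVt⟩⟩ := hs.exists_tight v hvb
    · refine ⟨t, ht, hst, hlt _ hst (Finset.card_lt_card ?_)⟩
      refine (Finset.ssubset_iff_of_subset (hJsub s v hv t)).mpr ⟨j, hv j hj.ne, ?_⟩
      rw [hJ]
      exact fun h => h.1 hj0
    · refine ⟨t, ht, hst, ?_⟩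
      by_cases hVb : V = ⊥
      · subst hVb
        exact hbot _ hst (hJsub s v hv t) hV (by simpa using hVt)
      · refine factor _ hst V hVb ?_ hVt
        rintro rfl
        rw [imageCodim_top hℓ] at hV
        exact hV.false
  have tight : ∀ s : ι → ℝ, BLFeasible ℓ s →
      (∀ s', BLFeasible ℓ s' → (J s').card < (J s).card → LocalBL ℓ s' μ ν) →
      imageCodim ℓ s ⊥ = finrank ℝ E → LocalBL ℓ s μ ν := by
    intro s hs hlt hbot
    rcases (J s).eq_empty_or_nonempty with h0 | ⟨i, hi⟩
    · refine LocalBL.of_trivial hs.1 fun j => ?_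
      have : j ∉ J s := by simp [h0]
      rw [hJ] at this
      tauto
    by_cases h1 : ∀ j, j ≠ i → j ∉ J s
    · have h2 : ∀ j, j ≠ i → s j = 0 ∨ finrank ℝ (F j) = 0 := fun j hj => by
        have := h1 j hj
        rw [hJ] at this
        tauto
      obtain ⟨h3, h4⟩ := hs.eq_one_and_bijective hℓ ((hJ s i).mp hi).2 h2 hbot
      exact LocalBL.of_bijective hs.1 i h2 h3 h4
    push Not at h1
    obtain ⟨k, hki, hk⟩ := h1
    have hni : (0 : ℝ) < finrank ℝ (F i) := by
      exact_mod_cast Nat.pos_of_ne_zero ((hJ s i).mp hi).2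
    have hnk : (0 : ℝ) < finrank ℝ (F k) := by
      exact_mod_cast Nat.pos_of_ne_zero ((hJ s k).mp hk).2
    -- This direction preserves ∑ s_j dim F_j, so 0 cannot be the newly tight subspace, and each of
    -- `v` and `-v` lowers an active exponent, so both motions stop.
    let v : ι → ℝ := fun j => if j = i then (finrank ℝ (F i) : ℝ)⁻¹ else
      if j = k then -(finrank ℝ (F k) : ℝ)⁻¹ else 0
    have hvJ : ∀ j, v j ≠ 0 → j ∈ J s := by
      intro j hj
      by_cases hji : j = i
      · exact hji ▸ hi
      by_cases hjk : j = k
      · exact hjk ▸ hk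
      simp [v, hji, hjk] at hj
    have hvi : 0 < v i := by simp [v, hni]
    have hvk : v k < 0 := by simp [v, hki, hnk]
    have hv0 : imageCodim ℓ v ⊥ = 0 := by
      rw [imageCodim_bot, Finset.sum_eq_add i k hki.symm]
      · simp only [v, if_true, hki, if_false]
        rw [inv_mul_cancel₀ hni.ne', neg_mul, inv_mul_cancel₀ hnk.ne', add_neg_cancel]
      · rintro j - ⟨hji, hjk⟩
        simp [v, hji, hjk]
      · simp
      · simp
    obtain ⟨a, ha, hfa, hla⟩ := move s hs hlt v hvJ (Or.inl ⟨k, hvk⟩)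
      (fun _ _ _ h => absurd h (by rw [hv0]; exact lt_irrefl 0))
    obtain ⟨b, hb, hfb, hlb⟩ := move s hs hlt (fun j => -v j)
      (fun j hj => hvJ j (neg_ne_zero.mp hj)) (Or.inl ⟨i, neg_lt_zero.mpr hvi⟩)
      (fun _ _ _ h => absurd h (by rw [imageCodim_neg, hv0, neg_zero]; exact lt_irrefl 0))
    exact LocalBL.of_line ha hb hfa.1 hfb.1 hla hlb
  suffices H : ∀ k, ∀ s : ι → ℝ, BLFeasible ℓ s → (J s).card = k → LocalBL ℓ s μ ν from
    H _ s hs rfl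
  intro k
  induction k using Nat.strong_induction_on with
  | _ k ihk =>
  intro s hs hk
  have hlt : ∀ s', BLFeasible ℓ s' → (J s').card < (J s).card → LocalBL ℓ s' μ ν :=
    fun s' hs' h => ihk _ (hk ▸ h) s' hs' rfl
  rcases (J s).eq_empty_or_nonempty with h0 | ⟨i, hi⟩
  · refine LocalBL.of_trivial hs.1 fun j => ?_
    have : j ∉ J s := by simp [h0]
    rw [hJ] at this
    tauto
  -- Raising the i-th exponent may make 0 tight, which is the case `tight`. Lowering it cannot,
  -- since the left side of that constraint decreases.
  let v : ι → ℝ := Pi.single i 1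
  have hvJ : ∀ j, v j ≠ 0 → j ∈ J s := by
    intro j hj
    by_cases hji : j = i
    · exact hji ▸ hi
    · simp [v, hji] at hj
  have hv0 : ∀ j, 0 ≤ v j := fun j => by
    by_cases hji : j = i
    · subst hji; simp [v]
    · simp [v, hji]
  have hvb : 0 < imageCodim ℓ v ⊥ := by
    rw [imageCodim_bot, Finset.sum_eq_single i]
    · simpa [v] using Nat.pos_of_ne_zero ((hJ s i).mp hi).2
    · intro j _ hj
      simp [v, hj]
    · simp
  obtain ⟨a, ha, hfa, hla⟩ := move s hs hlt v hvJ (Or.inr ⟨⊥, hvb⟩)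
    (fun s' hs' hJs' _ htight => tight s' hs' (fun s'' hs'' h => hlt s'' hs''
      (h.trans_le (Finset.card_le_card hJs'))) htight)
  obtain ⟨b, hb, hfb, hlb⟩ := move s hs hlt (fun j => -v j)
    (fun j hj => hvJ j (neg_ne_zero.mp hj)) (Or.inl ⟨i, by simp [v]⟩)
    (fun _ _ _ h => absurd h (by rw [imageCodim_neg]; linarith))
  exact LocalBL.of_line ha hb hfa.1 hfb.1 hla hlb

/-- The dimension condition implies the local Brascamp–Lieb inequality. -/
theorem BLFeasible.localBL {ι E : Type*} [Fintype ι] {F : ι → Type*} [NormedAddCommGroup E]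
    [NormedSpace ℝ E] [FiniteDimensional ℝ E] [MeasurableSpace E] [BorelSpace E]
    [∀ j, NormedAddCommGroup (F j)] [∀ j, NormedSpace ℝ (F j)] [∀ j, FiniteDimensional ℝ (F j)]
    [∀ j, MeasurableSpace (F j)] [∀ j, BorelSpace (F j)] {ℓ : ∀ j, E →ₗ[ℝ] F j} {s : ι → ℝ}
    (hs : BLFeasible ℓ s) (hℓ : ∀ j, Function.Surjective (ℓ j))
    (μ : Measure E) (ν : ∀ j, Measure (F j)) [μ.IsAddHaarMeasure]
    [∀ j, (ν j).IsAddHaarMeasure] : LocalBL ℓ s μ ν :=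
  localBL_of_finrank_eq _ rfl hℓ hs

/-! ### The inequality for L^p norms, and room in the exponents. -/

theorem LinearMap.quasiMeasurePreserving_of_surjective {E F : Type*}
    [NormedAddCommGroup E] [NormedSpace ℝ E] [FiniteDimensional ℝ E] [MeasurableSpace E]
    [BorelSpace E] [NormedAddCommGroup F] [NormedSpace ℝ F] [MeasurableSpace F] [BorelSpace F]
    (f : E →ₗ[ℝ] F) (hf : Function.Surjective f) (μ : Measure E) (ν : Measure F)
    [μ.IsAddHaarMeasure] [ν.IsAddHaarMeasure] : Measure.QuasiMeasurePreserving f μ ν := by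
  have : ProperSpace E := FiniteDimensional.proper_real E
  obtain ⟨c, -, hc⟩ := f.exists_map_addHaar_eq_smul_addHaar μ ν hf
  refine ⟨f.continuous_of_finiteDimensional.measurable, ?_⟩
  rw [hc]
  exact Measure.smul_absolutelyContinuous

section
variable {ι E : Type*} [Fintype ι] {F : ι → Type*} [NormedAddCommGroup E] [NormedSpace ℝ E]
    [FiniteDimensional ℝ E]
    [MeasurableSpace E] [BorelSpace E] [∀ j, NormedAddCommGroup (F j)] [∀ j, NormedSpace ℝ (F j)]
    [∀ j, FiniteDimensional ℝ (F j)]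
    [∀ j, MeasurableSpace (F j)] [∀ j, BorelSpace (F j)] {ℓ : ∀ j, E →ₗ[ℝ] F j} {s : ι → ℝ}

/-- The local Brascamp–Lieb inequality in terms of `L^p` norms. -/
theorem BLFeasible.lintegral_prod_enorm_le {p : ι → ℝ≥0∞}
    (hs : BLFeasible ℓ fun j => (p j)⁻¹.toReal) (hp : ∀ j, p j ≠ 0)
    (hℓ : ∀ j, Function.Surjective (ℓ j))
    (μ : Measure E) (ν : ∀ j, Measure (F j)) [μ.IsAddHaarMeasure] [∀ j, (ν j).IsAddHaarMeasure]
    {K : Set E} (hK : Bornology.IsBounded K) :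
    ∃ C : ℝ≥0∞, C ≠ ∞ ∧ ∀ f : ∀ j, F j → ℂ, (∀ j, AEStronglyMeasurable (f j) (ν j)) →
      ∫⁻ x in K, ∏ j, ‖f j (ℓ j x)‖ₑ ∂μ ≤ C * ∏ j, eLpNorm (f j) (p j) (ν j) := by
  classical
  obtain ⟨C, hC, hCg⟩ := hs.localBL hℓ μ ν K hK
  refine ⟨C, hC, fun f hf => ?_⟩
  -- Factors with p_j = ∞ have exponent 0 and are taken out as constants; there `g j` may be 0
  -- because 0 ^ 0 = 1.
  let A : ι → ℝ≥0∞ := fun j => if p j = ∞ then eLpNorm (f j) ∞ (ν j) else 1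
  let g : ∀ j, F j → ℝ≥0∞ := fun j y =>
    if p j = ∞ then 0 else ‖(hf j).mk (f j) y‖ₑ ^ (p j).toReal
  have hg : ∀ j, Measurable (g j) := by
    intro j
    by_cases h : p j = ∞
    · simp only [g, h, if_true]
      exact measurable_const
    · simp only [g, h, if_false]
      exact (hf j).stronglyMeasurable_mk.measurable.enorm.pow_const _
  have hq := fun j => (ℓ j).quasiMeasurePreserving_of_surjective (hℓ j) μ (ν j)
  have hptw : ∀ j, ∀ᵐ x ∂μ, ‖f j (ℓ j x)‖ₑ ≤ A j * g j (ℓ j x) ^ (p j)⁻¹.toReal := by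
    intro j
    by_cases h : p j = ∞
    · have h1 : ∀ᵐ y ∂ν j, ‖f j y‖ₑ ≤ eLpNorm (f j) ∞ (ν j) := by
        rw [eLpNorm_exponent_top]
        exact enorm_ae_le_eLpNormEssSup _ _
      filter_upwards [(hq j).ae h1] with x hx
      simpa [A, g, h] using hx
    · filter_upwards [(hq j).ae (hf j).ae_eq_mk] with x hx
      simp only [A, g, h, if_false, one_mul]
      rw [← ENNReal.rpow_mul, ENNReal.toReal_inv,
        mul_inv_cancel₀ (ENNReal.toReal_ne_zero.mpr ⟨hp j, h⟩), ENNReal.rpow_one, hx]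
  have hnorm : ∀ j, A j * (∫⁻ y, g j y ∂ν j) ^ (p j)⁻¹.toReal = eLpNorm (f j) (p j) (ν j) := by
    intro j
    by_cases h : p j = ∞
    · simp [A, h]
    · simp only [A, g, h, if_false, one_mul]
      rw [eLpNorm_congr_ae (hf j).ae_eq_mk, eLpNorm_eq_lintegral_rpow_enorm_toReal (hp j) h,
        ENNReal.toReal_inv, one_div]
  calc _ ≤ ∫⁻ x in K, (∏ j, A j) * ∏ j, g j (ℓ j x) ^ (p j)⁻¹.toReal ∂μ := by
        refine lintegral_mono_ae (ae_restrict_of_ae ?_)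
        filter_upwards [ae_all_iff.mpr hptw] with x hx
        rw [← Finset.prod_mul_distrib]
        exact Finset.prod_le_prod' fun j _ => hx j
    _ ≤ (∏ j, A j) * (C * ∏ j, (∫⁻ y, g j y ∂ν j) ^ (p j)⁻¹.toReal) := by
        rw [lintegral_const_mul _ (measurable_prod_comp_rpow ℓ _ hg)]
        gcongr
        exact hCg g hg
    _ = _ := by
        simp only [← hnorm, Finset.prod_mul_distrib]
        ring

theorem BLFeasible.mono {t : ι → ℝ} (hs : BLFeasible ℓ s) (ht0 : ∀ j, 0 ≤ t j)
    (hts : ∀ j, t j ≤ s j) : BLFeasible ℓ t :=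
  ⟨ht0, fun V => (Finset.sum_le_sum fun j _ => mul_le_mul_of_nonneg_right (hts j)
    (sub_nonneg.mpr (by exact_mod_cast Submodule.finrank_le _))).trans (hs.2 V)⟩

open Module in
/-- Strictly feasible exponents may be increased a little. -/
theorem exists_feasible_add (hs0 : ∀ j, 0 ≤ s j) (hℓ : ∀ j, Function.Surjective (ℓ j))
    (hs : ∀ V : Submodule ℝ E, V ≠ ⊤ → imageCodim ℓ s V < finrank ℝ E - finrank ℝ V) :
    ∃ ε : ℝ, 0 < ε ∧ BLFeasible ℓ fun j => s j + ε := by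
  have hf : BLFeasible ℓ s := by
    refine ⟨hs0, fun V => ?_⟩
    by_cases hV : V = ⊤
    · rw [hV, imageCodim_top hℓ, finrank_top, sub_self]
    · exact (hs V hV).le
  by_cases h : ∃ V, 0 < imageCodim ℓ (fun _ => 1) V
  · obtain ⟨t, ht, hft, ⟨j, hj, -⟩ | ⟨V, hV, hVt⟩⟩ := hf.exists_tight (fun _ => 1) (Or.inr h)
    · norm_num at hj
    simp only [mul_one] at hft
    refine ⟨t, ht.lt_of_ne' ?_, hft⟩
    -- A hitting time of zero would make some V ≠ ⊤ tight for `s` itself, against strictness.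
    rintro rfl
    have hVT : V ≠ ⊤ := by
      rintro rfl
      rw [imageCodim_top hℓ] at hV
      exact hV.false
    have := hs V hVT
    simp only [zero_mul, add_zero] at hVt
    linarith
  · push Not at h
    refine ⟨1, one_pos, fun j => by linarith [hs0 j], fun V => ?_⟩
    have h1 := imageCodim_add_mul ℓ s (fun _ => 1) 1 V
    simp only [mul_one, one_mul] at h1
    linarith [hf.2 V, h V]
end

/-! ### Truncation of functions and of products. -/

/-- Truncation: the part of `f` above the threshold `τ ‖f‖_p` is small in a lower `L^q`. -/
theorem eLpNorm_indicator_large_le {α : Type*} [MeasurableSpace α] {ν : Measure α} {f : α → ℂ}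
    {p : ℝ≥0∞} (hp : 1 ≤ p) (hf : MemLp f p ν) {ε : ℝ} (hε : 0 < ε) {τ : ℝ≥0∞} (hτ : 1 ≤ τ)
    (hτt : τ ≠ ∞) :
    eLpNorm ({y | τ * eLpNorm f p ν < ‖f y‖ₑ}.indicator f) (p⁻¹ + ENNReal.ofReal ε)⁻¹ ν
      ≤ τ ^ (-ε) * eLpNorm f p ν := by
  set M := eLpNorm f p ν with hM
  have hp0 : p ≠ 0 := (zero_lt_one.trans_le hp).ne'
  have hMt : M ≠ ∞ := hf.2.ne
  have zero_case : (∀ᵐ y ∂ν, ‖f y‖ₑ ≤ τ * M) →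
      eLpNorm ({y | τ * M < ‖f y‖ₑ}.indicator f) (p⁻¹ + ENNReal.ofReal ε)⁻¹ ν
        ≤ τ ^ (-ε) * M := by
    intro h
    have : {y | τ * M < ‖f y‖ₑ}.indicator f =ᵐ[ν] 0 := by
      filter_upwards [h] with y hy
      exact Set.indicator_of_notMem (show y ∉ {y | τ * M < ‖f y‖ₑ} from not_lt.mpr hy) f
    rw [eLpNorm_congr_ae this, eLpNorm_zero]
    exact zero_le
  by_cases hpt : p = ∞
  · refine zero_case ?_
    have h1 : ∀ᵐ y ∂ν, ‖f y‖ₑ ≤ M := by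
      rw [hM, hpt, eLpNorm_exponent_top]
      exact enorm_ae_le_eLpNormEssSup _ _
    filter_upwards [h1] with y hy
    exact hy.trans (le_mul_of_one_le_left zero_le hτ)
  by_cases hM0 : M = 0
  · refine zero_case ?_
    filter_upwards [(eLpNorm_eq_zero_iff hf.1 hp0).mp hM0] with y hy
    simp [hy]
  set r := p.toReal with hr
  have hr1 : 1 ≤ r := by
    rw [hr, ← ENNReal.toReal_one]
    exact ENNReal.toReal_mono hpt hp
  have hr0 : 0 < r := one_pos.trans_le hr1
  have hpinv : p⁻¹ ≠ ∞ := ENNReal.inv_ne_top.mpr hp0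
  set q := (r⁻¹ + ε)⁻¹ with hq
  have hq0 : 0 < q := by positivity
  have hqreal : ((p⁻¹ + ENNReal.ofReal ε)⁻¹).toReal = q := by
    rw [ENNReal.toReal_inv, ENNReal.toReal_add hpinv ENNReal.ofReal_ne_top, ENNReal.toReal_inv,
      ENNReal.toReal_ofReal hε.le]
  have hq1 : (p⁻¹ + ENNReal.ofReal ε)⁻¹ ≠ 0 :=
    ENNReal.inv_ne_zero.mpr (ENNReal.add_ne_top.mpr ⟨hpinv, ENNReal.ofReal_ne_top⟩)
  have hq2 : (p⁻¹ + ENNReal.ofReal ε)⁻¹ ≠ ∞ :=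
    ENNReal.inv_ne_top.mpr (by simp [hε])
  have hqinv : q⁻¹ = r⁻¹ + ε := inv_inv _
  have hqr : q ≤ r := by
    rw [← inv_le_inv₀ hr0 hq0, hqinv]
    linarith
  have hMr : ∫⁻ y, ‖f y‖ₑ ^ r ∂ν = M ^ r := by
    rw [hM, eLpNorm_eq_lintegral_rpow_enorm_toReal hp0 hpt, ← ENNReal.rpow_mul,
      one_div_mul_cancel hr0.ne', ENNReal.rpow_one]
  have hτ0 : τ ≠ 0 := (zero_lt_one.trans_le hτ).ne'
  have hτM0 : τ * M ≠ 0 := mul_ne_zero hτ0 hM0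
  have hτMt : τ * M ≠ ∞ := ENNReal.mul_ne_top hτt hMt
  -- Chebyshev's argument: q - r ≤ 0, so |f|^(q - r) is at most its value at the threshold.
  -- Integrating gains τ^(-rε), which is at most τ^(-ε) since r ≥ 1.
  have hptw : ∀ y, ‖{y | τ * M < ‖f y‖ₑ}.indicator f y‖ₑ ^ q ≤ (τ * M) ^ (q - r) * ‖f y‖ₑ ^ r := by
    intro y
    by_cases hy : τ * M < ‖f y‖ₑ
    · rw [Set.indicator_of_mem (show y ∈ {y | τ * M < ‖f y‖ₑ} from hy)]
      have h0 : ‖f y‖ₑ ≠ 0 := (zero_le.trans_lt hy).ne'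
      calc ‖f y‖ₑ ^ q = ‖f y‖ₑ ^ (q - r) * ‖f y‖ₑ ^ r := by
            rw [← ENNReal.rpow_add _ _ h0 enorm_ne_top, sub_add_cancel]
        _ ≤ _ := by
            gcongr ?_ * _
            rw [← neg_sub r q, ENNReal.rpow_neg, ENNReal.rpow_neg, ENNReal.inv_le_inv]
            exact ENNReal.rpow_le_rpow hy.le (by linarith)
    · rw [Set.indicator_of_notMem (show y ∉ {y | τ * M < ‖f y‖ₑ} from hy)]
      simp [hq0]
  rw [eLpNorm_eq_lintegral_rpow_enorm_toReal hq1 hq2, hqreal, one_div]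
  have e1 : (q - r) * q⁻¹ = -(r * ε) := by
    rw [sub_mul, mul_inv_cancel₀ hq0.ne', hqinv, mul_add, mul_inv_cancel₀ hr0.ne']
    ring
  have e2 : r * q⁻¹ = 1 + r * ε := by
    rw [hqinv, mul_add, mul_inv_cancel₀ hr0.ne']
  calc _ ≤ (∫⁻ y, (τ * M) ^ (q - r) * ‖f y‖ₑ ^ r ∂ν) ^ q⁻¹ :=
        ENNReal.rpow_le_rpow (lintegral_mono hptw) (inv_nonneg.mpr hq0.le)
    _ = τ ^ (-(r * ε)) * M := by
        rw [lintegral_const_mul' _ _ (ENNReal.rpow_ne_top_of_ne_zero hτM0 hτMt), hMr,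
          ENNReal.mul_rpow_of_nonneg _ _ (inv_nonneg.mpr hq0.le), ← ENNReal.rpow_mul,
          ← ENNReal.rpow_mul, e1, e2, ENNReal.mul_rpow_of_ne_zero hτ0 hM0, mul_assoc,
          ← ENNReal.rpow_add _ _ hM0 hMt]
        simp
    _ ≤ _ := by
        gcongr ?_ * _
        exact ENNReal.rpow_le_rpow_of_exponent_le hτ (by nlinarith)

/-- Replacing each factor of a product by zero where it is large. -/
theorem enorm_prod_sub_prod_indicator_le {ι : Type*} [Fintype ι] [DecidableEq ι] (z : ι → ℂ)
    (L : ι → Prop) [DecidablePred L] :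
    ‖∏ j, z j - ∏ j, (if L j then 0 else z j)‖ₑ ≤
      ∑ i, ∏ j, ‖if j = i then (if L i then z i else 0) else z j‖ₑ := by
  by_cases h : ∃ i, L i
  · obtain ⟨i, hi⟩ := h
    rw [Finset.prod_eq_zero (f := fun j => if L j then 0 else z j) (Finset.mem_univ i)
      (if_pos hi), sub_zero]
    refine le_trans (le_of_eq ?_) (Finset.single_le_sum (fun _ _ => zero_le)
      (Finset.mem_univ i))
    have : ‖∏ j, z j‖ₑ = ∏ j, ‖z j‖ₑ := by
      simp only [enorm_eq_nnnorm, nnnorm_prod, ENNReal.ofNNReal_finsetProd]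
    rw [this]
    refine Finset.prod_congr rfl fun j _ => ?_
    by_cases hj : j = i
    · subst hj; simp [hi]
    · simp [hj]
  · push Not at h
    simp [h]

/-! ### Bounds for the oscillatory form without using oscillation. -/

section
variable {n m : ℕ} {d : Fin m → ℕ}
    {ℓ : (j : Fin m) → EuclideanSpace ℝ (Fin n) →ₗ[ℝ] EuclideanSpace ℝ (Fin (d j))}
    {P : MvPolynomial (Fin n) ℝ} {φ : EuclideanSpace ℝ (Fin n) → ℂ}

theorem enorm_exp_I_mul_ofReal (t : ℝ) : ‖Complex.exp (Complex.I * (t : ℂ))‖ₑ = 1 := by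
  rw [← ofReal_norm, mul_comm, Complex.norm_exp_ofReal_mul_I, ENNReal.ofReal_one]

theorem enorm_fin_prod {ι : Type*} [Fintype ι] (z : ι → ℂ) : ‖∏ j, z j‖ₑ = ∏ j, ‖z j‖ₑ := by
  simp only [enorm_eq_nnnorm, nnnorm_prod, ENNReal.ofNNReal_finsetProd]

theorem aestronglyMeasurable_oscIntegrand (hℓ : ∀ j, Function.Surjective (ℓ j))
    (hφ : Continuous φ) (lam : ℝ) {f : (j : Fin m) → EuclideanSpace ℝ (Fin (d j)) → ℂ}
    (hf : ∀ j, AEStronglyMeasurable (f j) volume) :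
    AEStronglyMeasurable (oscIntegrand ℓ P φ lam f) volume := by
  have hP : Continuous fun x : EuclideanSpace ℝ (Fin n) =>
      MvPolynomial.eval (fun i => x i) P :=
    (MvPolynomial.continuous_eval P).comp (by fun_prop)
  refine AEStronglyMeasurable.mul (AEStronglyMeasurable.mul ?_ ?_) hφ.aestronglyMeasurable
  · exact Continuous.aestronglyMeasurable (by fun_prop)
  · refine Finset.aestronglyMeasurable_fun_prod _ fun j _ => ?_
    exact (hf j).comp_quasiMeasurePreserving
      ((ℓ j).quasiMeasurePreserving_of_surjective (hℓ j) volume volume)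

theorem exists_lintegral_le_of_enorm_le_mul (hφ : Continuous φ) (hφc : HasCompactSupport φ) :
    ∃ B : ℝ≥0∞, B ≠ ∞ ∧ ∀ (u : EuclideanSpace ℝ (Fin n) → ℂ)
      (G : EuclideanSpace ℝ (Fin n) → ℝ≥0∞), (∀ x, ‖u x‖ₑ ≤ G x * ‖φ x‖ₑ) →
      ∫⁻ x, ‖u x‖ₑ ≤ B * ∫⁻ x in tsupport φ, G x := by
  obtain ⟨b, hb⟩ := hφ.bounded_above_of_compact_support hφc
  refine ⟨ENNReal.ofReal b, ENNReal.ofReal_ne_top, fun u G h => ?_⟩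
  rw [← lintegral_const_mul' _ _ ENNReal.ofReal_ne_top,
    ← lintegral_indicator (isClosed_tsupport φ).measurableSet]
  refine lintegral_mono fun x => (h x).trans ?_
  by_cases hx : x ∈ tsupport φ
  · rw [Set.indicator_of_mem hx, mul_comm]
    gcongr
    rw [← ofReal_norm]
    exact ENNReal.ofReal_le_ofReal (hb x)
  · rw [image_eq_zero_of_notMem_tsupport hx]
    simp

theorem exists_lintegral_enorm_oscIntegrand_le (hℓ : ∀ j, Function.Surjective (ℓ j))
    (P : MvPolynomial (Fin n) ℝ) (hφ : Continuous φ) (hφc : HasCompactSupport φ)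
    {p : Fin m → ℝ≥0∞} (hp : ∀ j, p j ≠ 0) (hs : BLFeasible ℓ fun j => (p j)⁻¹.toReal) :
    ∃ C : ℝ≥0∞, C ≠ ∞ ∧ ∀ f : (j : Fin m) → EuclideanSpace ℝ (Fin (d j)) → ℂ,
      (∀ j, AEStronglyMeasurable (f j) volume) → ∀ lam : ℝ,
        ∫⁻ x, ‖oscIntegrand ℓ P φ lam f x‖ₑ ≤ C * ∏ j, eLpNorm (f j) (p j) volume := by
  obtain ⟨B, hB, hBu⟩ := exists_lintegral_le_of_enorm_le_mul hφ hφc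
  obtain ⟨C, hC, hCf⟩ := hs.lintegral_prod_enorm_le hp hℓ volume (fun _ => volume)
    (IsCompact.isBounded hφc : Bornology.IsBounded (tsupport φ))
  refine ⟨B * C, ENNReal.mul_ne_top hB hC, fun f hf lam => ?_⟩
  refine (hBu _ (fun x => ∏ j, ‖f j (ℓ j x)‖ₑ) fun x => ?_).trans ?_
  · rw [oscIntegrand, enorm_mul, enorm_mul, enorm_exp_I_mul_ofReal, one_mul, enorm_fin_prod]
  · rw [mul_assoc]
    gcongr
    exact hCf f hf

/-- The form changes little when all functions are truncated. -/
theorem exists_enorm_oscForm_sub_le (hℓ : ∀ j, Function.Surjective (ℓ j))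
    (P : MvPolynomial (Fin n) ℝ) (hφ : Continuous φ) (hφc : HasCompactSupport φ)
    {p : Fin m → ℝ≥0∞} (hp : ∀ j, 1 ≤ p j) {ε : ℝ} (hε : 0 < ε)
    (hs : BLFeasible ℓ fun j => (p j)⁻¹.toReal + ε) :
    ∃ D : ℝ≥0∞, D ≠ ∞ ∧ ∀ f : (j : Fin m) → EuclideanSpace ℝ (Fin (d j)) → ℂ,
      (∀ j, MemLp (f j) (p j) volume) → ∀ τ : ℝ≥0∞, 1 ≤ τ → τ ≠ ∞ → ∀ lam : ℝ,
        ‖oscForm ℓ P φ lam f - oscForm ℓ P φ lam (fun j =>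
          {y | τ * eLpNorm (f j) (p j) volume < ‖f j y‖ₑ}ᶜ.indicator (f j))‖ₑ
          ≤ D * τ ^ (-ε) * ∏ j, eLpNorm (f j) (p j) volume := by
  classical
  have hp0 : ∀ j, p j ≠ 0 := fun j => (zero_lt_one.trans_le (hp j)).ne'
  have hpinv : ∀ j, (p j)⁻¹ ≠ ∞ := fun j => ENNReal.inv_ne_top.mpr (hp0 j)
  obtain ⟨B, hB, hBu⟩ := exists_lintegral_le_of_enorm_le_mul hφ hφc
  have hsp : BLFeasible ℓ fun j => (p j)⁻¹.toReal :=
    hs.mono (fun j => ENNReal.toReal_nonneg) (fun j => by linarith)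
  -- In the i-th error term only the i-th function is cut to its large values, so only its exponent
  -- is lowered. Feasibility follows by monotonicity from raising all the 1/p_j.
  let p' : Fin m → Fin m → ℝ≥0∞ := fun i j =>
    if j = i then ((p i)⁻¹ + ENNReal.ofReal ε)⁻¹ else p j
  have hp'0 : ∀ i j, p' i j ≠ 0 := by
    intro i j
    by_cases h : j = i
    · simp only [p', h, if_true]
      exact ENNReal.inv_ne_zero.mpr (ENNReal.add_ne_top.mpr ⟨hpinv i, ENNReal.ofReal_ne_top⟩)
    · simpa only [p', h, if_false] using hp0 j
  have hsp' : ∀ i, BLFeasible ℓ fun j => (p' i j)⁻¹.toReal := by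
    refine fun i => hs.mono (fun j => ENNReal.toReal_nonneg) fun j => ?_
    by_cases h : j = i
    · simp only [p', h, if_true, inv_inv]
      rw [ENNReal.toReal_add (hpinv i) ENNReal.ofReal_ne_top, ENNReal.toReal_ofReal hε.le]
    · simp only [p', h, if_false]
      linarith
  choose C hC hCf using fun i => (hsp' i).lintegral_prod_enorm_le (hp'0 i) hℓ volume
    (fun _ => volume) (IsCompact.isBounded hφc : Bornology.IsBounded (tsupport φ))
  obtain ⟨C₀, hC₀, hC₀f⟩ := exists_lintegral_enorm_oscIntegrand_le hℓ P hφ hφc hp0 hsp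
  have hint : ∀ (lam : ℝ) (f : (j : Fin m) → EuclideanSpace ℝ (Fin (d j)) → ℂ),
      (∀ j, MemLp (f j) (p j) volume) → Integrable (oscIntegrand ℓ P φ lam f) volume :=
    fun lam f hf => ⟨aestronglyMeasurable_oscIntegrand hℓ hφ lam fun j => (hf j).1,
      (hC₀f f (fun j => (hf j).1) lam).trans_lt (ENNReal.mul_lt_top hC₀.lt_top
        (ENNReal.prod_lt_top fun j _ => (hf j).2))⟩
  refine ⟨B * ∑ i, C i, ENNReal.mul_ne_top hB (ENNReal.sum_ne_top.mpr fun i _ => hC i),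
    fun f hf τ hτ hτt lam => ?_⟩
  let S : ∀ j, Set (EuclideanSpace ℝ (Fin (d j))) := fun j =>
    {y | τ * eLpNorm (f j) (p j) volume < ‖f j y‖ₑ}
  have hS : ∀ j, NullMeasurableSet (S j) volume := fun j =>
    nullMeasurableSet_lt aemeasurable_const (hf j).1.enorm
  let f₀ : ∀ j, EuclideanSpace ℝ (Fin (d j)) → ℂ := fun j => (S j)ᶜ.indicator (f j)
  have hf₀ : ∀ j, MemLp (f₀ j) (p j) volume := fun j =>
    (hf j).mono ((hf j).1.indicator₀ (hS j).compl)
      (Filter.Eventually.of_forall fun y => norm_indicator_le_norm_self _ _)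
  let f₁ : ∀ i j, EuclideanSpace ℝ (Fin (d j)) → ℂ := fun i j =>
    if j = i then (S j).indicator (f j) else f j
  have hf₁ : ∀ i j, AEStronglyMeasurable (f₁ i j) volume := by
    intro i j
    by_cases h : j = i
    · simp only [f₁, h, if_true]
      exact (hf j).1.indicator₀ (hS j)
    · simpa only [f₁, h, if_false] using (hf j).1
  have hprod : ∀ i, ∏ j, eLpNorm (f₁ i j) (p' i j) volume ≤
      τ ^ (-ε) * ∏ j, eLpNorm (f j) (p j) volume := by
    intro i
    rw [← Finset.mul_prod_erase _ _ (Finset.mem_univ i),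
      ← Finset.mul_prod_erase _ (fun j => eLpNorm (f j) (p j) volume) (Finset.mem_univ i),
      ← mul_assoc]
    refine mul_le_mul' ?_ (le_of_eq (Finset.prod_congr rfl fun j hj => ?_))
    · simp only [f₁, p', if_true]
      exact eLpNorm_indicator_large_le (hp i) (hf i) hε hτ hτt
    · simp only [f₁, p', Finset.ne_of_mem_erase hj, if_false]
  have hdiff : ∀ x, ‖oscIntegrand ℓ P φ lam f x - oscIntegrand ℓ P φ lam f₀ x‖ₑ ≤
      (∑ i, ∏ j, ‖f₁ i j (ℓ j x)‖ₑ) * ‖φ x‖ₑ := by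
    intro x
    rw [oscIntegrand, oscIntegrand, ← sub_mul, ← mul_sub, enorm_mul, enorm_mul,
      enorm_exp_I_mul_ofReal, one_mul]
    gcongr
    have e₀ : ∀ j, f₀ j (ℓ j x) = if ℓ j x ∈ S j then 0 else f j (ℓ j x) := by
      intro j
      by_cases h : ℓ j x ∈ S j <;> simp [f₀, h]
    have e₁ : ∀ i j, f₁ i j (ℓ j x) =
        if j = i then (if ℓ i x ∈ S i then f i (ℓ i x) else 0) else f j (ℓ j x) := by
      intro i j
      by_cases h : j = i
      · subst h
        by_cases h : ℓ j x ∈ S j <;> simp [f₁, h]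
      · simp [f₁, h]
    simp only [e₀, e₁]
    exact enorm_prod_sub_prod_indicator_le (fun j => f j (ℓ j x)) (fun j => ℓ j x ∈ S j)
  rw [oscForm, oscForm, ← integral_sub (hint lam f hf) (hint lam f₀ hf₀)]
  calc _ ≤ ∫⁻ x, ‖oscIntegrand ℓ P φ lam f x - oscIntegrand ℓ P φ lam f₀ x‖ₑ :=
        enorm_integral_le_lintegral_enorm _
    _ ≤ B * ∫⁻ x in tsupport φ, ∑ i, ∏ j, ‖f₁ i j (ℓ j x)‖ₑ := hBu _ _ hdiff
    _ = B * ∑ i, ∫⁻ x in tsupport φ, ∏ j, ‖f₁ i j (ℓ j x)‖ₑ := by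
        rw [lintegral_finsetSum' _ fun i _ => ?_]
        refine AEMeasurable.restrict ?_
        refine Finset.aemeasurable_fun_prod _ fun j _ => ?_
        exact ((hf₁ i j).comp_quasiMeasurePreserving
          ((ℓ j).quasiMeasurePreserving_of_surjective (hℓ j) volume volume)).enorm
    _ ≤ B * ∑ i, C i * (τ ^ (-ε) * ∏ j, eLpNorm (f j) (p j) volume) := by
        gcongr with i
        exact (hCf i _ (hf₁ i)).trans (by gcongr; exact hprod i)
    _ = _ := by
        rw [← Finset.sum_mul]
        ring
end

/-! ### Choice of the threshold and conclusion. -/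

theorem codim_cast {E : Type*} [AddCommGroup E] [Module ℝ E] [FiniteDimensional ℝ E]
    (V : Submodule ℝ E) :
    (codim V : ℝ) = Module.finrank ℝ E - Module.finrank ℝ V := by
  rw [← V.finrank_quotient_add_finrank, codim]
  push_cast
  ring

theorem norm_le_of_enorm_le_mul_prod {m : ℕ} {z : ℂ} {c : ℝ≥0∞} (hc : c ≠ ∞)
    {N : Fin m → ℝ≥0∞} (hN : ∀ j, N j ≠ ∞) (h : ‖z‖ₑ ≤ c * ∏ j, N j) :
    ‖z‖ ≤ c.toReal * ∏ j, (N j).toReal := by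
  rw [← toReal_enorm, ← ENNReal.toReal_prod, ← ENNReal.toReal_mul]
  exact ENNReal.toReal_mono (ENNReal.mul_ne_top hc (ENNReal.prod_ne_top fun j _ => hN j)) h

theorem proposition3p1 {n m : ℕ} (hm : 1 < m) (d : Fin m → ℕ)
    (ℓ : (j : Fin m) → EuclideanSpace ℝ (Fin n) →ₗ[ℝ] EuclideanSpace ℝ (Fin (d j)))
    (hℓ : ∀ j, Function.Surjective (ℓ j))
    (P : MvPolynomial (Fin n) ℝ)
    (φ : EuclideanSpace ℝ (Fin n) → ℂ) (hφ : ContDiff ℝ 1 φ) (hφc : HasCompactSupport φ)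
    (hdecay : ∃ δ : ℝ, 0 < δ ∧ ∃ C : ℝ,
      ∀ f : (j : Fin m) → EuclideanSpace ℝ (Fin (d j)) → ℂ,
        (∀ j, MemLp (f j) ∞ volume) → ∀ lam : ℝ, lam ≠ 0 →
          ‖oscForm ℓ P φ lam f‖ ≤
            C * |lam| ^ (-δ) * ∏ j, (eLpNorm (f j) ∞ volume).toReal)
    (p : Fin m → ℝ≥0∞) (hp : ∀ j, 1 ≤ p j)
    (hV : ∀ V : Submodule ℝ (EuclideanSpace ℝ (Fin n)), V ≠ ⊤ →
      ∑ j, ((p j)⁻¹).toReal * (codim (V.map (ℓ j)) : ℝ) < (codim V : ℝ)) :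
    (∀ f : (j : Fin m) → EuclideanSpace ℝ (Fin (d j)) → ℂ,
      (∀ j, MemLp (f j) (p j) volume) → ∀ lam : ℝ,
        Integrable (oscIntegrand ℓ P φ lam f) volume) ∧
    ∃ δ : ℝ, 0 < δ ∧ ∃ C : ℝ,
      ∀ f : (j : Fin m) → EuclideanSpace ℝ (Fin (d j)) → ℂ,
        (∀ j, MemLp (f j) (p j) volume) → ∀ lam : ℝ, lam ≠ 0 →
          ‖oscForm ℓ P φ lam f‖ ≤
            C * |lam| ^ (-δ) * ∏ j, (eLpNorm (f j) (p j) volume).toReal := by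
  have hp0 : ∀ j, p j ≠ 0 := fun j => (zero_lt_one.trans_le (hp j)).ne'
  obtain ⟨ε, hε, hfε⟩ := exists_feasible_add (ℓ := ℓ) (s := fun j => (p j)⁻¹.toReal)
    (fun j => ENNReal.toReal_nonneg) hℓ (fun V hVT => by
      simpa only [imageCodim, codim_cast] using hV V hVT)
  have hf0 : BLFeasible ℓ fun j => (p j)⁻¹.toReal :=
    hfε.mono (fun j => ENNReal.toReal_nonneg) (fun j => by linarith)
  obtain ⟨C₀, hC₀, hC₀f⟩ := exists_lintegral_enorm_oscIntegrand_le hℓ P hφ.continuous hφc hp0 hf0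
  obtain ⟨D, hD, hDf⟩ := exists_enorm_oscForm_sub_le hℓ P hφ.continuous hφc hp hε hfε
  obtain ⟨δ, hδ, C, hC⟩ := hdecay
  refine ⟨fun f hf lam => ⟨aestronglyMeasurable_oscIntegrand hℓ hφ.continuous lam
    fun j => (hf j).1, (hC₀f f (fun j => (hf j).1) lam).trans_lt (ENNReal.mul_lt_top hC₀.lt_top
        (ENNReal.prod_lt_top fun j _ => (hf j).2))⟩, ?_⟩
  have hm0 : (0 : ℝ) < m := by exact_mod_cast zero_lt_one.trans hm
  -- With threshold |λ|^a the m truncated functions cost |λ|^(ma) = |λ|^(δ/2), half of the available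
  -- decay; the discarded parts contribute |λ|^(-aε).
  set a : ℝ := δ / (2 * m) with ha
  have ha0 : 0 < a := by positivity
  refine ⟨min (δ / 2) (a * ε), by positivity, C₀.toReal + |C| + D.toReal, fun f hf lam hlam => ?_⟩
  have habs : 0 < |lam| := abs_pos.mpr hlam
  have hNt : ∀ j, eLpNorm (f j) (p j) volume ≠ ∞ := fun j => (hf j).2.ne
  set N : Fin m → ℝ≥0∞ := fun j => eLpNorm (f j) (p j) volume
  set Q : ℝ := ∏ j, (N j).toReal with hQ
  have hQ0 : 0 ≤ Q := Finset.prod_nonneg fun j _ => ENNReal.toReal_nonneg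
  set δ' := min (δ / 2) (a * ε) with hδ'
  have hX0 : 0 ≤ |lam| ^ (-δ') := by positivity
  -- For |λ| < 1 the bound without decay suffices, since the power of |λ| is at least 1.
  rcases lt_or_ge |lam| 1 with h1 | h1
  · have hbound : ‖oscForm ℓ P φ lam f‖ ≤ C₀.toReal * Q :=
      norm_le_of_enorm_le_mul_prod hC₀ hNt ((enorm_integral_le_lintegral_enorm _).trans
        (hC₀f f (fun j => (hf j).1) lam))
    have hX : 1 ≤ |lam| ^ (-δ') :=
      Real.one_le_rpow_of_pos_of_le_one_of_nonpos habs h1.le (neg_nonpos.mpr (by positivity))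
    calc _ ≤ C₀.toReal * Q := hbound
      _ ≤ (C₀.toReal + |C| + D.toReal) * 1 * Q := by
        rw [mul_one]
        gcongr
        linarith [abs_nonneg C, ENNReal.toReal_nonneg (a := D)]
      _ ≤ _ := by gcongr
  set T : ℝ := |lam| ^ a with hT
  have hT0 : 0 < T := by positivity
  have hT1 : 1 ≤ T := Real.one_le_rpow h1 ha0.le
  set τ : ℝ≥0∞ := ENNReal.ofReal T with hτ
  have hτ1 : 1 ≤ τ := ENNReal.one_le_ofReal.mpr hT1
  have hτr : τ.toReal = T := ENNReal.toReal_ofReal hT0.le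
  set f₀ : (j : Fin m) → EuclideanSpace ℝ (Fin (d j)) → ℂ := fun j =>
    {y | τ * N j < ‖f j y‖ₑ}ᶜ.indicator (f j)
  have hτN : ∀ j, τ * N j ≠ ∞ := fun j => ENNReal.mul_ne_top ENNReal.ofReal_ne_top (hNt j)
  have hf₀b : ∀ j, eLpNorm (f₀ j) ∞ volume ≤ τ * N j := by
    intro j
    rw [eLpNorm_exponent_top]
    refine eLpNormEssSup_le_of_ae_enorm_bound (Filter.Eventually.of_forall fun y => ?_)
    by_cases hy : τ * N j < ‖f j y‖ₑ
    · have : f₀ j y = 0 := Set.indicator_of_notMem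
        (show y ∉ {y | τ * N j < ‖f j y‖ₑ}ᶜ from fun h => h hy) _
      simp [this]
    · have : f₀ j y = f j y := Set.indicator_of_mem
        (show y ∈ {y | τ * N j < ‖f j y‖ₑ}ᶜ from hy) _
      rw [this]
      exact not_lt.mp hy
  have hf₀m : ∀ j, MemLp (f₀ j) ∞ volume := fun j =>
    ⟨(hf j).1.indicator₀ (nullMeasurableSet_lt aemeasurable_const (hf j).1.enorm).compl,
      (hf₀b j).trans_lt (hτN j).lt_top⟩
  have hsmall : ‖oscForm ℓ P φ lam f₀‖ ≤ |C| * |lam| ^ (-(δ / 2)) * Q := by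
    calc _ ≤ C * |lam| ^ (-δ) * ∏ j, (eLpNorm (f₀ j) ∞ volume).toReal := hC f₀ hf₀m lam hlam
      _ ≤ |C| * |lam| ^ (-δ) * ∏ j, (T * (N j).toReal) := by
        gcongr with j
        · exact le_abs_self C
        · rw [← hτr, ← ENNReal.toReal_mul]
          exact ENNReal.toReal_mono (hτN j) (hf₀b j)
      _ = _ := by
        rw [Finset.prod_mul_distrib, Finset.prod_const, Finset.card_univ, Fintype.card_fin, ← hQ,
          hT, ← Real.rpow_natCast, ← Real.rpow_mul habs.le, ← mul_assoc, mul_assoc |C|,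
          ← Real.rpow_add habs]
        congr 3
        rw [ha]
        field_simp
        ring
  have hlarge : ‖oscForm ℓ P φ lam f - oscForm ℓ P φ lam f₀‖ ≤
      D.toReal * |lam| ^ (-(a * ε)) * Q := by
    have hτε : (τ ^ (-ε)) = ENNReal.ofReal (|lam| ^ (-(a * ε))) := by
      rw [hτ, ENNReal.ofReal_rpow_of_pos hT0, hT, ← Real.rpow_mul habs.le, mul_neg]
    have h2 := hDf f hf τ hτ1 ENNReal.ofReal_ne_top lam
    rw [hτε] at h2
    have h3 := norm_le_of_enorm_le_mul_prod (ENNReal.mul_ne_top hD ENNReal.ofReal_ne_top) hNt h2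
    rwa [ENNReal.toReal_mul, ENNReal.toReal_ofReal (by positivity)] at h3
  have hX1 : |lam| ^ (-(δ / 2)) ≤ |lam| ^ (-δ') :=
    Real.rpow_le_rpow_of_exponent_le h1 (neg_le_neg (min_le_left _ _))
  have hX2 : |lam| ^ (-(a * ε)) ≤ |lam| ^ (-δ') :=
    Real.rpow_le_rpow_of_exponent_le h1 (neg_le_neg (min_le_right _ _))
  calc _ = ‖oscForm ℓ P φ lam f₀ + (oscForm ℓ P φ lam f - oscForm ℓ P φ lam f₀)‖ := by
        rw [add_sub_cancel]
    _ ≤ |C| * |lam| ^ (-(δ / 2)) * Q + D.toReal * |lam| ^ (-(a * ε)) * Q :=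
        (norm_add_le _ _).trans (add_le_add hsmall hlarge)
    _ ≤ |C| * |lam| ^ (-δ') * Q + D.toReal * |lam| ^ (-δ') * Q := by gcongr
    _ ≤ (C₀.toReal + |C| + D.toReal) * |lam| ^ (-δ') * Q := by
        have : 0 ≤ C₀.toReal * |lam| ^ (-δ') * Q := by positivity
        linarith
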